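/- For $r=1,2$ let $-\infty<\alpha_r<\beta_r<\infty$, $n_r\ge 1$, and let $\mathcal F_r=\{\varphi_{n_r,i}\}_{i=0}^{n_r}\subset C^{n_r}([\alpha_r,\beta_r])$, $\varphi_{n_r,0}\equiv 1$, be an ordinary extended Chebyshev (EC) basis of its span $\mathbb S_r$; that is, for all knots $\alpha_r\le x_0<\dots<x_q\le\beta_r$, all positive integers $m_0,\dots,m_q$ with $\sum_k m_k=n_r+1$ and all real numbers $\xi_{k,l}$ there is exactly one linear combination $f=\sum_{i=0}^{n_r} c_i\varphi_{n_r,i}$ (with unique coefficients $c_i$) such that $f^{(l)}(x_k)=\xi_{k,l}$ for $0\le k\le q$, $0\le l<m_k$. Let $\{b_{n_r,j}\}_{j=0}^{n_r}$ be a normalized B-basis of $\mathbb S_r$: a totally positive system of functions in $\mathbb S_r$ (all minors of all its collocation matrices are nonnegative) with $\sum_j b_{n_r,j}\equiv 1$ on $[\alpha_r,\beta_r]$, $b_{n_r,0}(\alpha_r)=b_{n_r,n_r}(\beta_r)=1$, and, for $i=0,\dots,n_r$, $$b_{n_r,i}^{(l)}(\alpha_r)=0\ (0\le l<i),\quad b_{n_r,i}^{(i)}(\alpha_r)>0,\quad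 b_{n_r,i}^{(l)}(\beta_r)=0\ (0\le l<n_r-i),\quad (-1)^{n_r-i}\,b_{n_r,i}^{(n_r-i)}(\beta_r)>0 .$$ Then the normalized B-basis of $\mathbb S_r$ is unique, and there is exactly one matrix $[t^{n_r}_{i,j}]_{i,j=0}^{n_r}$ with $\varphi_{n_r,i}(x)=\sum_{j=0}^{n_r} t^{n_r}_{i,j}\,b_{n_r,j}(x)$ for all $x\in[\alpha_r,\beta_r]$ and all $i$; this matrix is regular. Moreover, for all integers $\sigma_1,\sigma_2,\sigma_3\ge1$ and all real numbers $\lambda^{\ell,\zeta}_{r,i}$ ($\ell=1,2,3$, $\zeta=1,\dots,\sigma_\ell$, $r=1,2$, $i=0,\dots,n_r$), the ordinary integral surface $\mathbf s=[s^1,s^2,s^3]^T$ on $[\alpha_1,\beta_1]\times[\alpha_2,\beta_2]$ with $$s^\ell(u_1,u_2)=\sum_{\zeta=1}^{\sigma_\ell}\ \prod_{r=1}^{2}\ \Bigl(\sum_{i=0}^{n_r}\lambda^{\ell,\zeta}_{r,i}\,\varphi_{n_r,i}(u_r)\Bigr)$$ equals the tensor product EC B-surface $$\mathbf s(u_1,u_2)=\sum_{j_1=0}^{n_1}\sum_{j_2=0}^{n_2}\mathbf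 p_{j_1,j_2}\,b_{n_1,j_1}(u_1)\,b_{n_2,j_2}(u_2)\qquad\text{for all }(u_1,u_2)\in[\alpha_1,\beta_1]\times[\alpha_2,\beta_2],$$ where the control net $\mathbf p_{j_1,j_2}=[p^\ell_{j_1,j_2}]_{\ell=1}^3\in\mathbb R^3$ is given by $$p^\ell_{j_1,j_2}=\sum_{\zeta=1}^{\sigma_\ell}\ \prod_{r=1}^{2} p^{\ell,\zeta}_{r,j_r},\qquad p^{\ell,\zeta}_{r,j}=\sum_{i=0}^{n_r}\lambda^{\ell,\zeta}_{r,i}\,t^{n_r}_{i,j}.$$ -/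

import Mathlib

open Set

/-- A system `φ 0, …, φ n` of functions on `[α, β]` that is an ordinary extended Chebyshev (EC)
basis of its linear span: `φ 0` is the constant `1`, every `φ i` is of class `C^n` on `[α, β]`
(one-sided derivatives at the endpoints), and every Hermite interpolation problem with `n + 1`
conditions in total (with arbitrary knots `u 0 < … < u r` in `[α, β]`, positive multiplicities
`m 0, …, m r` and data `ξ k l`) has exactly one solution `∑ i, c i * φ i`. -/
structure IsOrdinaryECBasis {n : ℕ} (α β : ℝ) (φ : Fin (n + 1) → ℝ → ℝ) : Prop where
  lt : α < β
  one : ∀ x ∈ Icc α β, φ 0 x = 1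
  contDiffOn : ∀ i, ContDiffOn ℝ (n : WithTop ℕ∞) (φ i) (Icc α β)
  hermite : ∀ (r : ℕ) (u : Fin (r + 1) → ℝ) (m : Fin (r + 1) → ℕ) (ξ : Fin (r + 1) → ℕ → ℝ),
    StrictMono u → (∀ k, u k ∈ Icc α β) → (∀ k, 0 < m k) → ∑ k, m k = n + 1 →
    ∃! c : Fin (n + 1) → ℝ, ∀ k, ∀ l < m k,
      iteratedDerivWithin l (fun x => ∑ i, c i * φ i x) (Icc α β) (u k) = ξ k l

/-- A system of functions is totally positive on `[α, β]`: all minors of all its collocation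
matrices are nonnegative. -/
def IsTotallyPositiveOn {n : ℕ} (α β : ℝ) (b : Fin (n + 1) → ℝ → ℝ) : Prop :=
  ∀ (k : ℕ) (x : Fin k → ℝ) (J : Fin k → Fin (n + 1)),
    StrictMono x → (∀ a, x a ∈ Icc α β) → StrictMono J →
    0 ≤ (Matrix.of fun a c => b (J c) (x a)).det

/-- `b 0, …, b n` is a normalized B-basis of the linear span of `φ 0, …, φ n` on `[α, β]`:
a totally positive (in particular nonnegative) system in the span that forms a partition of unity,
interpolates at the endpoints and has the prescribed orders of vanishing (and signs of the first
nonvanishing derivatives) at the endpoints. That the `b j` form a basis of the span is not a field: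
it follows from the other properties. -/
structure IsNormalizedBBasis {n : ℕ} (α β : ℝ) (φ b : Fin (n + 1) → ℝ → ℝ) : Prop where
  mem_span : ∀ j, ∃ c : Fin (n + 1) → ℝ, ∀ x ∈ Icc α β, b j x = ∑ i, c i * φ i x
  totallyPositive : IsTotallyPositiveOn α β b
  sum_eq_one : ∀ x ∈ Icc α β, ∑ j, b j x = 1
  left_eq_one : b 0 α = 1
  right_eq_one : b (Fin.last n) β = 1
  deriv_left_eq_zero : ∀ (i : Fin (n + 1)) (l : ℕ), l < (i : ℕ) →
    iteratedDerivWithin l (b i) (Icc α β) α = 0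
  deriv_left_pos : ∀ i : Fin (n + 1), 0 < iteratedDerivWithin (i : ℕ) (b i) (Icc α β) α
  deriv_right_eq_zero : ∀ (i : Fin (n + 1)) (l : ℕ), l < n - (i : ℕ) →
    iteratedDerivWithin l (b i) (Icc α β) β = 0
  deriv_right_pos : ∀ i : Fin (n + 1),
    0 < (-1 : ℝ) ^ (n - (i : ℕ)) * iteratedDerivWithin (n - (i : ℕ)) (b i) (Icc α β) β

/-- The matrix `t` transforms the system `b` to the system `φ` on `[α, β]`. -/
def Transforms {n : ℕ} (α β : ℝ) (t : Matrix (Fin (n + 1)) (Fin (n + 1)) ℝ)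
    (b φ : Fin (n + 1) → ℝ → ℝ) : Prop :=
  ∀ i, ∀ x ∈ Icc α β, φ i x = ∑ j, t i j * b j x

/-- The ordinary integral surface: its `l`-th coordinate is the sum over `z` of the products
over `r` of the linear combinations `∑ i, lam l z r i * φ r i (u r)`. -/
def ordinarySurface {n : Fin 2 → ℕ} (φ : (r : Fin 2) → Fin (n r + 1) → ℝ → ℝ) {σ : Fin 3 → ℕ}
    (lam : (l : Fin 3) → Fin (σ l) → (r : Fin 2) → Fin (n r + 1) → ℝ) (u : Fin 2 → ℝ) :
    Fin 3 → ℝ :=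
  fun l => ∑ z, ∏ r, ∑ i, lam l z r i * φ r i (u r)

/-- The tensor product surface with blending functions `b 0`, `b 1` and control net `p`. -/
def tensorSurface {n : Fin 2 → ℕ} (b : (r : Fin 2) → Fin (n r + 1) → ℝ → ℝ)
    (p : Fin (n 0 + 1) → Fin (n 1 + 1) → Fin 3 → ℝ) (u : Fin 2 → ℝ) : Fin 3 → ℝ :=
  ∑ j₁, ∑ j₂, (b 0 j₁ (u 0) * b 1 j₂ (u 1)) • p j₁ j₂

/-- The univariate control coordinate `∑ i, c i * t i j`. -/
def controlCoord {n : ℕ} (c : Fin (n + 1) → ℝ) (t : Matrix (Fin (n + 1)) (Fin (n + 1)) ℝ)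
    (j : Fin (n + 1)) : ℝ :=
  ∑ i, c i * t i j

/-- The control net: its `l`-th coordinate at `(j₁, j₂)` is the sum over `z` of the products of
the two univariate control coordinates. -/
def controlNet {n : Fin 2 → ℕ} {σ : Fin 3 → ℕ}
    (lam : (l : Fin 3) → Fin (σ l) → (r : Fin 2) → Fin (n r + 1) → ℝ)
    (t : (r : Fin 2) → Matrix (Fin (n r + 1)) (Fin (n r + 1)) ℝ)
    (j₁ : Fin (n 0 + 1)) (j₂ : Fin (n 1 + 1)) : Fin 3 → ℝ :=
  fun l => ∑ z, controlCoord (lam l z 0) (t 0) j₁ * controlCoord (lam l z 1) (t 1) j₂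

/-! Everything rests on unique Hermite interpolation at the endpoints: an element of the span with
`n + 1` zeros at `α` and `β`, counted with multiplicity, is zero. The prescribed zeros of `b j`
number `j + (n - j) = n`, which fixes it up to a factor (`exists_eqOn_const_mul`). The factors all
equal 1, since both systems sum to 1 and a B-basis is linearly independent. Independence also makes
the coefficient matrix of `b` in terms of `φ` invertible; its inverse is the transformation matrix.
The surface identity is then bilinear expansion. -/

/-- Iterated derivatives commute with finite linear combinations of `C^n` functions. -/
theorem iteratedDerivWithin_linearCombination {ι : Type*} [Fintype ι] {n l : ℕ} (hl : l ≤ n)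
    {s : Set ℝ} (hs : UniqueDiffOn ℝ s) {x : ℝ} (hx : x ∈ s) {f : ι → ℝ → ℝ}
    (hf : ∀ i, ContDiffOn ℝ (n : WithTop ℕ∞) (f i) s) (c : ι → ℝ) :
    iteratedDerivWithin l (fun y => ∑ i, c i * f i y) s x =
      ∑ i, c i * iteratedDerivWithin l (f i) s x := by
  have hl' : (l : WithTop ℕ∞) ≤ n := by exact_mod_cast hl
  rw [iteratedDerivWithin_fun_sum hx hs
    fun i _ => (contDiffOn_const.mul ((hf i).of_le hl')).contDiffWithinAt hx]
  refine Finset.sum_congr rfl fun i _ => ?_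
  exact iteratedDerivWithin_const_mul hx hs (c i) (((hf i).of_le hl').contDiffWithinAt hx)

namespace IsOrdinaryECBasis

variable {n : ℕ} {α β : ℝ} {φ : Fin (n + 1) → ℝ → ℝ}

/-- A linear combination with a zero of order `p > 0` at `α` and one of order `n + 1 - p` at `β`
is trivial. -/
theorem eq_zero_of_endpoint_zeros (hφ : IsOrdinaryECBasis α β φ) {p q : ℕ} (hp : 0 < p)
    (hpq : p + q = n + 1) (c : Fin (n + 1) → ℝ)
    (hα : ∀ l < p, iteratedDerivWithin l (fun x => ∑ i, c i * φ i x) (Icc α β) α = 0)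
    (hβ : ∀ l < q, iteratedDerivWithin l (fun x => ∑ i, c i * φ i x) (Icc α β) β = 0) :
    c = 0 := by
  have hα_mem : α ∈ Icc α β := left_mem_Icc.2 hφ.lt.le
  have hβ_mem : β ∈ Icc α β := right_mem_Icc.2 hφ.lt.le
  have hzero (l : ℕ) (x : ℝ) : iteratedDerivWithin l
      (fun x => ∑ i, (0 : Fin (n + 1) → ℝ) i * φ i x) (Icc α β) x = 0 := by
    simp
  -- Multiplicities must be positive, so `q = 0` needs the problem with the single knot `α`.
  rcases Nat.eq_zero_or_pos q with rfl | hq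
  · refine (hφ.hermite 0 (fun _ => α) (fun _ => p) 0 (fun i j h => by omega)
      (fun _ => hα_mem) (fun _ => hp) (by simpa using hpq)).unique ?_ ?_
    · exact fun _ l hl => hα l hl
    · exact fun _ l _ => hzero l _
  · refine (hφ.hermite 1 ![α, β] ![p, q] 0 ?_ ?_ ?_ ?_).unique ?_ ?_
    · simpa [Fin.strictMono_iff_lt_succ] using hφ.lt
    · exact Fin.forall_fin_two.2 ⟨hα_mem, hβ_mem⟩
    · exact Fin.forall_fin_two.2 ⟨hp, hq⟩
    · simpa using hpq
    · exact Fin.forall_fin_two.2 ⟨fun l hl => hα l hl, fun l hl => hβ l hl⟩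
    · exact fun _ l _ => hzero l _

/-- An ordinary EC basis is linearly independent on `[α, β]`. -/
theorem eq_zero_of_eqOn_zero (hφ : IsOrdinaryECBasis α β φ) (c : Fin (n + 1) → ℝ)
    (h : ∀ x ∈ Icc α β, ∑ i, c i * φ i x = 0) : c = 0 := by
  have hα_mem : α ∈ Icc α β := left_mem_Icc.2 hφ.lt.le
  refine hφ.eq_zero_of_endpoint_zeros (p := n + 1) (q := 0) n.succ_pos rfl c (fun l _ => ?_)
    (by simp)
  rw [iteratedDerivWithin_congr (g := fun _ => (0 : ℝ)) h hα_mem]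
  simp

end IsOrdinaryECBasis

namespace IsNormalizedBBasis

variable {n : ℕ} {α β : ℝ} {φ b b' : Fin (n + 1) → ℝ → ℝ}

theorem contDiffOn (hφ : IsOrdinaryECBasis α β φ) (hb : IsNormalizedBBasis α β φ b)
    (j : Fin (n + 1)) : ContDiffOn ℝ (n : WithTop ℕ∞) (b j) (Icc α β) := by
  obtain ⟨c, hc⟩ := hb.mem_span j
  exact (ContDiffOn.sum fun i _ => contDiffOn_const.mul (hφ.contDiffOn i)).congr hc

/-- A normalized B-basis is linearly independent on `[α, β]`: its Wronskian matrix at `α` is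
triangular with positive diagonal. -/
theorem eq_zero_of_eqOn_zero (hφ : IsOrdinaryECBasis α β φ) (hb : IsNormalizedBBasis α β φ b)
    (c : Fin (n + 1) → ℝ) (h : ∀ x ∈ Icc α β, ∑ j, c j * b j x = 0) (j : Fin (n + 1)) :
    c j = 0 := by
  have hα_mem : α ∈ Icc α β := left_mem_Icc.2 hφ.lt.le
  induction j using WellFoundedLT.induction with
  | ind j ih =>
    have hD : iteratedDerivWithin j (fun x => ∑ i, c i * b i x) (Icc α β) α = 0 := by
      rw [iteratedDerivWithin_congr (g := fun _ => (0 : ℝ)) h hα_mem]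
      simp
    rw [iteratedDerivWithin_linearCombination (Nat.lt_succ_iff.1 j.2) (uniqueDiffOn_Icc hφ.lt)
      hα_mem (hb.contDiffOn hφ), Finset.sum_eq_single j] at hD
    · exact (mul_eq_zero.1 hD).resolve_right (hb.deriv_left_pos j).ne'
    · intro i _ hij
      rcases hij.lt_or_gt with hlt | hgt
      · rw [ih i hlt, zero_mul]
      · rw [hb.deriv_left_eq_zero i j hgt, mul_zero]
    · simp

/-- Corresponding members of two normalized B-bases of the same span are proportional. -/
theorem exists_eqOn_const_mul (hφ : IsOrdinaryECBasis α β φ) (hb : IsNormalizedBBasis α β φ b)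
    (hb' : IsNormalizedBBasis α β φ b') (j : Fin (n + 1)) :
    ∃ κ : ℝ, ∀ x ∈ Icc α β, b' j x = κ * b j x := by
  have hα_mem : α ∈ Icc α β := left_mem_Icc.2 hφ.lt.le
  have hβ_mem : β ∈ Icc α β := right_mem_Icc.2 hφ.lt.le
  have hjn : (j : ℕ) ≤ n := Nat.lt_succ_iff.1 j.2
  obtain ⟨c, hc⟩ := hb.mem_span j
  obtain ⟨c', hc'⟩ := hb'.mem_span j
  -- This ratio cancels the derivative of order `j` at `α`, adding the one zero still missing to the
  -- `n` shared ones.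
  set κ := iteratedDerivWithin j (b' j) (Icc α β) α / iteratedDerivWithin j (b j) (Icc α β) α
    with hκ
  have hsum (x : ℝ) (hx : x ∈ Icc α β) :
      ∑ i, (c' i - κ * c i) * φ i x = b' j x - κ * b j x := by
    rw [hc x hx, hc' x hx, Finset.mul_sum, ← Finset.sum_sub_distrib]
    exact Finset.sum_congr rfl fun i _ => by ring
  have hD {l : ℕ} (hl : l ≤ n) {x : ℝ} (hx : x ∈ Icc α β) :
      iteratedDerivWithin l (fun x => ∑ i, (c' i - κ * c i) * φ i x) (Icc α β) x =
        iteratedDerivWithin l (b' j) (Icc α β) x - κ * iteratedDerivWithin l (b j) (Icc α β) x := by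
    -- Written as a combination of the pair `b' j`, `b j`, the difference can be differentiated
    -- termwise.
    have h2 : EqOn (fun x => ∑ i, (c' i - κ * c i) * φ i x)
        (fun x => ∑ i, ![1, -κ] i * ![b' j, b j] i x) (Icc α β) := fun x hx => by
      simpa [sub_eq_add_neg] using hsum x hx
    rw [iteratedDerivWithin_congr h2 hx, iteratedDerivWithin_linearCombination hl
      (uniqueDiffOn_Icc hφ.lt) hx
      (Fin.forall_fin_two.2 ⟨hb'.contDiffOn hφ j, hb.contDiffOn hφ j⟩)]
    simp [sub_eq_add_neg]
  have h0 : (fun i => c' i - κ * c i) = 0 := by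
    refine hφ.eq_zero_of_endpoint_zeros (p := j + 1) (q := n - j) (Nat.succ_pos _) (by omega) _
      (fun l hl => ?_) (fun l hl => ?_)
    · rw [hD (by omega) hα_mem]
      rcases (Nat.lt_succ_iff.1 hl).lt_or_eq with hlt | rfl
      · rw [hb.deriv_left_eq_zero j l hlt, hb'.deriv_left_eq_zero j l hlt, mul_zero, sub_zero]
      · rw [hκ, div_mul_cancel₀ _ (hb.deriv_left_pos j).ne', sub_self]
    · rw [hD (by omega) hβ_mem, hb.deriv_right_eq_zero j l hl, hb'.deriv_right_eq_zero j l hl,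
        mul_zero, sub_zero]
  refine ⟨κ, fun x hx => sub_eq_zero.1 ?_⟩
  rw [← hsum x hx]
  exact Finset.sum_eq_zero fun i _ => by rw [show c' i - κ * c i = 0 from congrFun h0 i, zero_mul]

/-- The normalized B-basis is unique. -/
theorem eqOn (hφ : IsOrdinaryECBasis α β φ) (hb : IsNormalizedBBasis α β φ b)
    (hb' : IsNormalizedBBasis α β φ b') (j : Fin (n + 1)) : EqOn (b' j) (b j) (Icc α β) := by
  choose κ hκ using hb.exists_eqOn_const_mul hφ hb'
  -- Subtracting the two partitions of unity gives `∑ i, (κ i - 1) * b i = 0`.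
  have h := hb.eq_zero_of_eqOn_zero hφ (fun i => κ i - 1) fun x hx => by
    simp only [sub_mul, one_mul, Finset.sum_sub_distrib]
    rw [hb.sum_eq_one x hx, ← Finset.sum_congr rfl fun i _ => hκ i x hx, hb'.sum_eq_one x hx,
      sub_self]
  intro x hx
  rw [hκ j x hx, sub_eq_zero.1 (h j), one_mul]

/-- There is exactly one matrix that transforms the normalized B-basis to the EC basis, and it is
regular. -/
theorem exists_unique_transforms (hφ : IsOrdinaryECBasis α β φ)
    (hb : IsNormalizedBBasis α β φ b) :
    ∃ t : Matrix (Fin (n + 1)) (Fin (n + 1)) ℝ, Transforms α β t b φ ∧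
      (∀ t', Transforms α β t' b φ → t' = t) ∧ IsUnit t := by
  choose B hB using hb.mem_span
  have hcomb (v : Fin (n + 1) → ℝ) (x : ℝ) (hx : x ∈ Icc α β) :
      ∑ j, v j * b j x = ∑ i, Matrix.vecMul v (Matrix.of B) i * φ i x := by
    simp only [Matrix.vecMul, dotProduct, Matrix.of_apply, Finset.sum_mul]
    rw [Finset.sum_comm]
    refine Finset.sum_congr rfl fun j _ => ?_
    rw [hB j x hx, Finset.mul_sum]
    exact Finset.sum_congr rfl fun i _ => by ring
  have hunit : IsUnit (Matrix.of B) := by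
    rw [← Matrix.vecMul_injective_iff_isUnit]
    -- If `v` and `w` have the same image, `v - w` gives a vanishing combination of the `b j`.
    intro v w hvw
    have h := hb.eq_zero_of_eqOn_zero hφ (v - w) fun x hx => by
      rw [hcomb _ x hx, Matrix.sub_vecMul, sub_eq_zero.2 hvw]
      simp
    exact funext fun j => sub_eq_zero.1 (h j)
  have hdet : IsUnit (Matrix.of B).det := (Matrix.isUnit_iff_isUnit_det _).1 hunit
  have ht : Transforms α β (Matrix.of B)⁻¹ b φ := fun i x hx => by
    rw [hcomb _ x hx]
    rw [← Matrix.mul_apply_eq_vecMul, Matrix.nonsing_inv_mul _ hdet]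
    simp [Matrix.one_apply]
  refine ⟨(Matrix.of B)⁻¹, ht, fun t' ht' => ?_,
    (Matrix.isUnit_nonsing_inv_iff).2 hunit⟩
  ext i j
  refine sub_eq_zero.1 (hb.eq_zero_of_eqOn_zero hφ (fun j => t' i j - (Matrix.of B)⁻¹ i j)
    (fun x hx => ?_) j)
  simp only [sub_mul, Finset.sum_sub_distrib]
  rw [← ht' i x hx, ← ht i x hx, sub_self]

end IsNormalizedBBasis

/-- Linear combinations transform by the control coordinates. -/
theorem Transforms.sum_mul_eq {n : ℕ} {α β : ℝ} {t : Matrix (Fin (n + 1)) (Fin (n + 1)) ℝ}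
    {b φ : Fin (n + 1) → ℝ → ℝ} (ht : Transforms α β t b φ) (c : Fin (n + 1) → ℝ) {x : ℝ}
    (hx : x ∈ Icc α β) : ∑ i, c i * φ i x = ∑ j, controlCoord c t j * b j x := by
  simp only [controlCoord, Finset.sum_mul]
  rw [Finset.sum_comm]
  refine Finset.sum_congr rfl fun i _ => ?_
  rw [ht i x hx, Finset.mul_sum]
  exact Finset.sum_congr rfl fun j _ => by ring

/-- For each `z`, a product of two univariate B-basis expansions is a double sum over `j₁`, `j₂`;
moving the sum over `z` innermost collects the control points. -/
theorem ordinarySurface_eq_tensorSurface {n : Fin 2 → ℕ} {α β : Fin 2 → ℝ}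
    {φ b : (r : Fin 2) → Fin (n r + 1) → ℝ → ℝ}
    {t : (r : Fin 2) → Matrix (Fin (n r + 1)) (Fin (n r + 1)) ℝ}
    (ht : ∀ r, Transforms (α r) (β r) (t r) (b r) (φ r)) {σ : Fin 3 → ℕ}
    (lam : (l : Fin 3) → Fin (σ l) → (r : Fin 2) → Fin (n r + 1) → ℝ) {u : Fin 2 → ℝ}
    (hu : ∀ r, u r ∈ Icc (α r) (β r)) :
    ordinarySurface φ lam u = tensorSurface b (controlNet lam t) u := by
  funext l
  simp only [ordinarySurface, tensorSurface, controlNet, Fin.prod_univ_two, Finset.sum_apply,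
    Pi.smul_apply, smul_eq_mul]
  calc
    _ = ∑ z, ∑ j₁, ∑ j₂, b 0 j₁ (u 0) * b 1 j₂ (u 1) *
          (controlCoord (lam l z 0) (t 0) j₁ * controlCoord (lam l z 1) (t 1) j₂) := by
      refine Fintype.sum_congr _ _ fun z => ?_
      rw [(ht 0).sum_mul_eq _ (hu 0), (ht 1).sum_mul_eq _ (hu 1), Finset.sum_mul_sum]
      refine Fintype.sum_congr _ _ fun j₁ => Fintype.sum_congr _ _ fun j₂ => ?_
      ring
    _ = _ := by
      simp only [Finset.mul_sum]
      rw [Finset.sum_comm]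
      exact Fintype.sum_congr _ _ fun j₁ => Finset.sum_comm

theorem theorem3 (n : Fin 2 → ℕ) (α β : Fin 2 → ℝ)
    (φ b : (r : Fin 2) → Fin (n r + 1) → ℝ → ℝ)
    (hφ : ∀ r, IsOrdinaryECBasis (α r) (β r) (φ r))
    (hb : ∀ r, IsNormalizedBBasis (α r) (β r) (φ r) (b r)) :
    (∀ r, ∀ b' : Fin (n r + 1) → ℝ → ℝ, IsNormalizedBBasis (α r) (β r) (φ r) b' →
      ∀ j, Set.EqOn (b' j) (b r j) (Set.Icc (α r) (β r))) ∧
    ∃ t : (r : Fin 2) → Matrix (Fin (n r + 1)) (Fin (n r + 1)) ℝ,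
      (∀ r, Transforms (α r) (β r) (t r) (b r) (φ r) ∧
        (∀ t' : Matrix (Fin (n r + 1)) (Fin (n r + 1)) ℝ,
          Transforms (α r) (β r) t' (b r) (φ r) → t' = t r) ∧
        IsUnit (t r)) ∧
      ∀ (σ : Fin 3 → ℕ) (lam : (l : Fin 3) → Fin (σ l) → (r : Fin 2) → Fin (n r + 1) → ℝ)
        (u : Fin 2 → ℝ), (∀ r, u r ∈ Set.Icc (α r) (β r)) →
        ordinarySurface φ lam u = tensorSurface b (controlNet lam t) u := by
  refine ⟨fun r b' hb' j => (hb r).eqOn (hφ r) hb' j, ?_⟩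
  choose t ht using fun r => (hb r).exists_unique_transforms (hφ r)
  exact ⟨t, ht, fun σ lam u hu => ordinarySurface_eq_tensorSurface (fun r => (ht r).1) lam hu⟩
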